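/- Let $d\ge 1$, $\lambda>0$, and let $\eta$ be a homogeneous Poisson process of rate $\lambda$ on $\mathbb{R}^d$ (a random locally finite set of points). Let $l:(0,\infty)\to[0,\infty)$ be non-increasing, put $l(0):=\lim_{r\to 0}l(r)\in[0,\infty]$, and define $\Psi(y):=\sum_{x\in\eta} l(|x-y|)\in[0,\infty]$ for $y\in\mathbb{R}^d$. For $0<h<\infty$ let $\Psi_{\ge h}:=\{y\in\mathbb{R}^d:\Psi(y)\ge h\}$ and $\Psi_{>h}:=\{y\in\mathbb{R}^d:\Psi(y)>h\}$, and say that such a set percolates if it has an unbounded connected component. Then $$\mathbb{P}(\Psi_{\ge h}\text{ percolates})\in\{0,1\}\quad\text{and}\quad \mathbb{P}(\Psi_{>h}\text{ percolates})\in\{0,1\}.$$ Here $\mathbb{P}$ is the law of $\eta$ on the space of locally finite configurations, with the $\sigma$-algebra generated by the numbers of points in Borel sets. If $l$ is such that one of these two sets of configurations is not measurable for the completion of $\mathbb{P}$, the assertion for it is that its outer measure and its inner measure each lie in $\{0,1\}$. -/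

import Mathlib

open MeasureTheory ProbabilityTheory Set Filter Topology
open scoped NNReal ENNReal

namespace LevelsetPercolation

/-- A locally finite set of points of `ℝ^d` (a realization of a simple point process). -/
structure Config (d : ℕ) where
  /-- the set of points -/
  points : Set (EuclideanSpace ℝ (Fin d))
  /-- every bounded set contains only finitely many of the points -/
  locallyFinite : ∀ B : Set (EuclideanSpace ℝ (Fin d)),
    Bornology.IsBounded B → (points ∩ B).Finite

/-- The number of points of the configuration in the set `B`. -/
noncomputable def Config.count {d : ℕ} (ξ : Config d) (B : Set (EuclideanSpace ℝ (Fin d))) : ℕ∞ :=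
  (ξ.points ∩ B).encard

/-- The usual σ-algebra on configurations: the smallest one that makes all the counts
`ξ ↦ ξ.count B`, `B` Borel, measurable. -/
noncomputable instance Config.instMeasurableSpace (d : ℕ) : MeasurableSpace (Config d) :=
  ⨆ B : {B : Set (EuclideanSpace ℝ (Fin d)) // MeasurableSet B},
    MeasurableSpace.comap (fun ξ : Config d => ξ.count B.1) inferInstance

/-- `η` is a homogeneous Poisson process of rate `lam` on `ℝ^d`, defined on `(Ω, P)`: the number of
points in a Borel set `B` of finite volume has the Poisson distribution with mean `lam * |B|`, and
the numbers of points in finitely many pairwise disjoint Borel sets are independent. -/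
structure IsPoissonProcess {Ω : Type*} [MeasurableSpace Ω] {d : ℕ} (lam : ℝ≥0)
    (η : Ω → Config d) (P : Measure Ω) : Prop where
  measurable : Measurable η
  count_law : ∀ B : Set (EuclideanSpace ℝ (Fin d)), MeasurableSet B → volume B ≠ ∞ →
    ∀ k : ℕ, P {ω | (η ω).count B = (k : ℕ∞)} = poissonMeasure (lam * (volume B).toNNReal) {k}
  indep : ∀ (n : ℕ) (B : Fin n → Set (EuclideanSpace ℝ (Fin d))), (∀ i, MeasurableSet (B i)) →
    Pairwise (fun i j => Disjoint (B i) (B j)) →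
    iIndepFun (fun i ω => (η ω).count (B i)) P

/-- The function `l : (0,∞) → [0,∞)`, extended to `0` by `l(0) = lim_{r → 0} l(r) ∈ [0,∞]`. As `l`
is non-increasing, this limit is the supremum of the values of `l` on `(0,∞)`. Only values of `l` at
positive arguments are used. -/
noncomputable def attenuation (l : ℝ → ℝ≥0) (r : ℝ) : ℝ≥0∞ :=
  if r = 0 then ⨆ s ∈ Ioi (0 : ℝ), (l s : ℝ≥0∞) else (l r : ℝ≥0∞)

/-- The field `Ψ(y) = ∑_{x ∈ ξ} l(|x - y|)`, with values in `[0,∞]`. -/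
noncomputable def field {d : ℕ} (l : ℝ → ℝ≥0) (ξ : Config d) (y : EuclideanSpace ℝ (Fin d)) :
    ℝ≥0∞ :=
  ∑' x : ξ.points, attenuation l ‖(x : EuclideanSpace ℝ (Fin d)) - y‖

/-- The level set `Ψ_{≥ h}`. -/
def levelGE {d : ℕ} (l : ℝ → ℝ≥0) (ξ : Config d) (h : ℝ) : Set (EuclideanSpace ℝ (Fin d)) :=
  {y | ENNReal.ofReal h ≤ field l ξ y}

/-- The level set `Ψ_{> h}`. -/
def levelGT {d : ℕ} (l : ℝ → ℝ≥0) (ξ : Config d) (h : ℝ) : Set (EuclideanSpace ℝ (Fin d)) :=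
  {y | ENNReal.ofReal h < field l ξ y}

/-- A set percolates if it has an unbounded connected component. -/
def Percolates {d : ℕ} (A : Set (EuclideanSpace ℝ (Fin d))) : Prop :=
  ∃ y ∈ A, ¬ Bornology.IsBounded (connectedComponentIn A y)

end LevelsetPercolation

/-!
The field of a translated configuration is the translated field, so the set of configurations whose
level set percolates is invariant under all translations, and so is its complement. The zero-one
law is therefore an instance of the ergodicity of the Poisson process under translations, in a form
that covers non-measurable sets: every translation-invariant set of configurations has outer measure
`0` or `1` (`IsPoissonProcess.map_eq_zero_or_one`).

Ergodicity is deduced from mixing, and the void events `{ξ | ξ ∩ B = ∅}` with `B` bounded and Borel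
suffice for this. They form a π-system, as the intersection of two void events is the void event of
the union. They generate the σ-algebra of configurations (`generateFrom_voidEvents`), because `B`
contains at least `k` points exactly when `k` disjoint pieces of `B`, cut out by sets of a countable
base, are each hit. The probability `exp (-lam * |B|)` of a void event depends on the volume of `B`
only, so that the law is translation invariant; and volumes add up over disjoint sets, so that the
void events of `A` and of a far translate of `B` are independent.

For a set `S` invariant under a mixing sequence of transformations
(`measure_eq_zero_or_one_of_mixing`), a measurable hull `H` of `S` is invariant up to null sets: the
intersection of `H` with its preimage still contains `S`, hence has the measure of `H`. Mixing
extends from the π-system to all measurable sets, first in one argument and then in the other, and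
makes `H` independent of itself.
-/

namespace LevelsetPercolation

/-! ### A zero-one law for invariant sets under mixing transformations -/

section ZeroOne

variable {α : Type*} [m : MeasurableSpace α] {μ : Measure α} [IsProbabilityMeasure μ]
  {C : Set (Set α)} {T : ℕ → α → α}

/-- Asymptotic independence passes from a generating π-system to all measurable sets in the
transformed argument: the sets `F` with this property form a λ-system, where countable disjoint
unions are handled by dominated convergence of series. -/
theorem tendsto_measureReal_inter_preimage (hgen : m = MeasurableSpace.generateFrom C)
    (hpi : IsPiSystem C) (hT : ∀ n, MeasurePreserving (T n) μ μ) {E : Set α}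
    (hE : MeasurableSet E)
    (hmix : ∀ F ∈ C, Tendsto (fun n => μ.real (E ∩ T n ⁻¹' F)) atTop (𝓝 (μ.real E * μ.real F)))
    {F : Set α} (hF : MeasurableSet F) :
    Tendsto (fun n => μ.real (E ∩ T n ⁻¹' F)) atTop (𝓝 (μ.real E * μ.real F)) := by
  induction F, hF using MeasurableSpace.induction_on_inter hgen hpi with
  | empty => simp
  | basic F hF => exact hmix F hF
  | compl F hF ih =>
    have h1 : ∀ n, μ.real (E ∩ T n ⁻¹' Fᶜ) = μ.real E - μ.real (E ∩ T n ⁻¹' F) := fun n => by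
      rw [preimage_compl, ← sdiff_eq,
        ← measureReal_inter_add_sdiff (s := E) ((hT n).measurable hF)]
      ring
    simp only [h1, probReal_compl_eq_one_sub hF, mul_sub, mul_one]
    exact tendsto_const_nhds.sub ih
  | iUnion F hd hF ih =>
    have hsum : ∀ G : ℕ → Set α, (∀ i, MeasurableSet (G i)) → Pairwise (Function.onFun Disjoint G) →
        HasSum (fun i => μ.real (G i)) (μ.real (⋃ i, G i)) := fun G hG hGd => by
      have h1 : ∑' i, μ (G i) = μ (⋃ i, G i) := (measure_iUnion hGd hG).symm
      have h2 := ENNReal.hasSum_toReal (h1 ▸ measure_ne_top μ _)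
      rwa [← ENNReal.tsum_toReal_eq (fun i => measure_ne_top μ _), h1] at h2
    have h1 : ∀ n, μ.real (E ∩ T n ⁻¹' ⋃ i, F i) = ∑' i, μ.real (E ∩ T n ⁻¹' F i) := fun n => by
      rw [preimage_iUnion, inter_iUnion]
      refine (hsum _ (fun i => hE.inter ((hT n).measurable (hF i))) fun i j hij => ?_).tsum_eq.symm
      exact ((hd hij).preimage _).mono inter_subset_right inter_subset_right
    have h2 := hsum F hF hd
    simp only [h1]
    rw [← h2.tsum_eq, ← tsum_mul_left]
    refine tendsto_tsum_of_dominated_convergence h2.summable ih (Eventually.of_forall fun n i => ?_)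
    rw [Real.norm_of_nonneg measureReal_nonneg,
      ← (hT n).measureReal_preimage (hF i).nullMeasurableSet]
    exact measureReal_mono inter_subset_right

/-- A set that is invariant under every transformation of a mixing sequence has outer measure `0`
or `1`. No measurability of the set is needed, since a measurable hull is still invariant up to null
sets. -/
theorem measure_eq_zero_or_one_of_mixing (hgen : m = MeasurableSpace.generateFrom C)
    (hpi : IsPiSystem C) (hT : ∀ n, MeasurePreserving (T n) μ μ)
    (hmix : ∀ E ∈ C, ∀ F ∈ C,
      Tendsto (fun n => μ.real (E ∩ T n ⁻¹' F)) atTop (𝓝 (μ.real E * μ.real F)))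
    {S : Set α} (hS : ∀ n, T n ⁻¹' S = S) : μ S = 0 ∨ μ S = 1 := by
  set H := toMeasurable μ S with hH
  have hHm : MeasurableSet H := measurableSet_toMeasurable μ S
  have hSH : S ⊆ H := subset_toMeasurable μ S
  have hμH : μ H = μ S := measure_toMeasurable S
  have hinv : ∀ n, T n ⁻¹' H =ᵐ[μ] H := fun n => by
    have hTm : MeasurableSet (T n ⁻¹' H) := (hT n).measurable hHm
    have hle : μ H ≤ μ (H ∩ T n ⁻¹' H) := by
      rw [hμH]
      exact measure_mono (subset_inter hSH ((hS n).symm.subset.trans (preimage_mono hSH)))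
    have h1 := ae_eq_of_subset_of_measure_ge inter_subset_left hle
      (hHm.inter hTm).nullMeasurableSet (measure_ne_top μ _)
    have h2 := ae_eq_of_subset_of_measure_ge inter_subset_right
      (((hT n).measure_preimage hHm.nullMeasurableSet).trans_le hle)
      (hHm.inter hTm).nullMeasurableSet (measure_ne_top μ _)
    exact h2.symm.trans h1
  have hC : ∀ E ∈ C, MeasurableSet E := fun E hE =>
    hgen ▸ MeasurableSpace.measurableSet_generateFrom hE
  have hind : ∀ E ∈ C, μ.real (E ∩ H) = μ.real E * μ.real H := fun E hE => by
    refine tendsto_nhds_unique (tendsto_const_nhds.congr fun n => ?_)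
      (tendsto_measureReal_inter_preimage hgen hpi hT (hC E hE) (hmix E hE) hHm)
    exact (measureReal_congr ((ae_eq_refl E).inter (hinv n))).symm
  have hrestrict : μ.restrict H = μ H • μ := by
    refine ext_of_generate_finite C hgen hpi (fun E hE => ?_) (by simp)
    rw [Measure.restrict_apply (hC E hE), Measure.smul_apply, smul_eq_mul, mul_comm,
      ← ENNReal.toReal_eq_toReal_iff' (measure_ne_top _ _)
        (ENNReal.mul_ne_top (measure_ne_top _ _) (measure_ne_top _ _)), ENNReal.toReal_mul]
    exact hind E hE
  have hsq : μ H = μ H * μ H := by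
    simpa using congrArg (fun ν : Measure α => ν H) hrestrict
  rw [← hμH]
  by_cases h0 : μ H = 0
  · exact Or.inl h0
  · exact Or.inr ((ENNReal.mul_eq_left h0 (measure_ne_top _ _)).1 hsq.symm)

end ZeroOne

/-! ### Void events generate the σ-algebra of configurations -/

section Void

variable {d : ℕ}

/-- The event that the set `B` contains no point of the configuration. -/
def voidEvent (B : Set (EuclideanSpace ℝ (Fin d))) : Set (Config d) :=
  {ξ | ξ.count B = 0}

/-- The collection of all void events of bounded Borel sets. -/
def voidEvents (d : ℕ) : Set (Set (Config d)) :=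
  {E | ∃ B, MeasurableSet B ∧ Bornology.IsBounded B ∧ voidEvent B = E}

theorem measurable_count {B : Set (EuclideanSpace ℝ (Fin d))} (hB : MeasurableSet B) :
    Measurable fun ξ : Config d => ξ.count B :=
  (comap_measurable _).mono
    (le_iSup (fun B : {B : Set (EuclideanSpace ℝ (Fin d)) // MeasurableSet B} =>
      MeasurableSpace.comap (fun ξ : Config d => ξ.count B.1) inferInstance) ⟨B, hB⟩) le_rfl

theorem mem_voidEvent {B : Set (EuclideanSpace ℝ (Fin d))} {ξ : Config d} :
    ξ ∈ voidEvent B ↔ ξ.points ∩ B = ∅ :=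
  encard_eq_zero

theorem measurableSet_voidEvent {B : Set (EuclideanSpace ℝ (Fin d))} (hB : MeasurableSet B) :
    MeasurableSet (voidEvent B) :=
  measurable_count hB (measurableSet_singleton 0)

theorem voidEvent_inter_voidEvent (A B : Set (EuclideanSpace ℝ (Fin d))) :
    voidEvent A ∩ voidEvent B = voidEvent (A ∪ B) := by
  ext ξ
  simp only [mem_inter_iff, mem_voidEvent, inter_union_distrib_left, union_empty_iff]

theorem isPiSystem_voidEvents : IsPiSystem (voidEvents d) := by
  rintro _ ⟨A, hA, hAb, rfl⟩ _ ⟨B, hB, hBb, rfl⟩ -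
  exact ⟨A ∪ B, hA.union hB, hAb.union hBb, (voidEvent_inter_voidEvent A B).symm⟩

/-- A set contains at least `k` points of a configuration if and only if `k` pairwise disjoint
bounded sets, cut out by sets of a countable base of the topology, each contain one. -/
theorem le_count_iff (ξ : Config d) (B : Set (EuclideanSpace ℝ (Fin d))) (k : ℕ) :
    (k : ℕ∞) ≤ ξ.count B ↔
      ∃ (r : ℕ) (U : Fin k → TopologicalSpace.countableBasis (EuclideanSpace ℝ (Fin d))),
        Pairwise (fun i j => Disjoint (U i : Set (EuclideanSpace ℝ (Fin d))) (U j)) ∧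
        ∀ i, ξ ∉ voidEvent (B ∩ U i ∩ Metric.closedBall 0 r) := by
  simp only [mem_voidEvent, ← ne_eq, ← nonempty_iff_ne_empty]
  constructor
  · intro hk
    obtain ⟨t, ht, htk⟩ := exists_subset_encard_eq hk
    have htfin : t.Finite := finite_of_encard_eq_coe htk
    have e : Fin k ≃ t := by
      have : Fintype t := htfin.fintype
      refine (Fintype.equivFinOfCardEq ?_).symm
      rw [← Nat.card_eq_fintype_card, Nat.card_coe_set_eq, ncard, htk, ENat.toNat_natCast]
    obtain ⟨V, hV, hVd⟩ := htfin.t2_separation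
    have hbasis := TopologicalSpace.isBasis_countableBasis (EuclideanSpace ℝ (Fin d))
    have hU : ∀ i : Fin k, ∃ U ∈ TopologicalSpace.countableBasis (EuclideanSpace ℝ (Fin d)),
        (e i : EuclideanSpace ℝ (Fin d)) ∈ U ∧ U ⊆ V (e i) := fun i =>
      hbasis.exists_subset_of_mem_open (hV _).1 (hV _).2
    choose U hUb hUm hUV using hU
    obtain ⟨r, hr⟩ := htfin.isBounded.subset_closedBall 0
    obtain ⟨n, hn⟩ := exists_nat_ge r
    refine ⟨n, fun i => ⟨U i, hUb i⟩, fun i j hij => ?_, fun i => ⟨e i, ?_⟩⟩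
    · exact (hVd (e i).2 (e j).2 fun h => hij (e.injective (Subtype.ext h))).mono (hUV i) (hUV j)
    · exact ⟨(ht (e i).2).1, ⟨(ht (e i).2).2, hUm i⟩,
        Metric.closedBall_subset_closedBall hn (hr (e i).2)⟩
  · rintro ⟨r, U, hd, hne⟩
    choose x hx using hne
    have hinj : Function.Injective x := fun i j hij => by
      by_contra hne
      exact disjoint_left.1 (hd hne) (hx i).2.1.2 (hij ▸ (hx j).2.1.2)
    calc (k : ℕ∞) = (range x).encard := by
          rw [← image_univ, hinj.encard_image]; simp
      _ ≤ ξ.count B := encard_le_encard (range_subset_iff.2 fun i => ⟨(hx i).1, (hx i).2.1.1⟩)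

/-- The void events of bounded Borel sets generate the σ-algebra of configurations: configurations
are sets of points, without multiplicities, so that their counts are determined by which sets they
hit. -/
theorem generateFrom_voidEvents :
    Config.instMeasurableSpace d = MeasurableSpace.generateFrom (voidEvents d) := by
  apply le_antisymm
  · refine iSup_le fun ⟨B, hB⟩ => Measurable.comap_le ?_
    let _ : MeasurableSpace (Config d) := MeasurableSpace.generateFrom (voidEvents d)
    have hge : ∀ k : ℕ, MeasurableSet {ξ : Config d | (k : ℕ∞) ≤ ξ.count B} := fun k => by
      simp only [le_count_iff, ofPred_exists, ofPred_and, ofPred_forall]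
      have := (TopologicalSpace.countable_countableBasis (EuclideanSpace ℝ (Fin d))).to_subtype
      refine MeasurableSet.iUnion fun r => MeasurableSet.iUnion fun U =>
        (MeasurableSet.const _).inter (MeasurableSet.iInter fun i => MeasurableSet.compl ?_)
      refine MeasurableSpace.measurableSet_generateFrom ⟨_, ?_, ?_, rfl⟩
      · exact (hB.inter (TopologicalSpace.isOpen_of_mem_countableBasis (U i).2).measurableSet).inter
          measurableSet_closedBall
      · exact Metric.isBounded_closedBall.subset inter_subset_right
    refine measurable_to_countable' fun a => ?_
    induction a with
    | top =>
      convert MeasurableSet.iInter hge using 1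
      ext ξ
      simp [ENat.eq_top_iff_forall_ge]
    | coe n =>
      convert (hge n).diff (hge (n + 1)) using 1
      ext ξ
      simp only [mem_preimage, mem_singleton_iff, Set.mem_sdiff, mem_ofPred_eq, Nat.cast_add,
        Nat.cast_one, not_le, ENat.lt_add_one_iff (ENat.natCast_ne_top n)]
      exact ⟨fun h => ⟨h.ge, h.le⟩, fun h => le_antisymm h.2 h.1⟩
  · refine MeasurableSpace.generateFrom_le ?_
    rintro _ ⟨B, hB, -, rfl⟩
    exact measurableSet_voidEvent hB

end Void

/-! ### Translations of configurations -/

section Shift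

variable {d : ℕ}

theorem isBounded_preimage_sub {B : Set (EuclideanSpace ℝ (Fin d))} (hB : Bornology.IsBounded B)
    (v : EuclideanSpace ℝ (Fin d)) : Bornology.IsBounded ((· - v) ⁻¹' B) := by
  have : (· - v) ⁻¹' B = (· + v) '' B := by
    rw [image_add_right]; simp [sub_eq_add_neg]
  rw [this]
  exact (LipschitzWith.id.add (LipschitzWith.const v)).isBounded_image hB

/-- The configuration translated by `-v`. -/
def Config.shift (v : EuclideanSpace ℝ (Fin d)) (ξ : Config d) : Config d where
  points := (· + v) ⁻¹' ξ.points
  locallyFinite B hB := by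
    have : (· + v) ⁻¹' ξ.points ∩ B = (· + v) ⁻¹' (ξ.points ∩ (· - v) ⁻¹' B) := by
      ext x; simp
    rw [this]
    refine Finite.preimage (add_left_injective v).injOn 
      (ξ.locallyFinite _ (isBounded_preimage_sub hB v))

theorem preimage_shift_voidEvent (v : EuclideanSpace ℝ (Fin d))
    (B : Set (EuclideanSpace ℝ (Fin d))) :
    Config.shift v ⁻¹' voidEvent B = voidEvent ((· - v) ⁻¹' B) := by
  ext ξ
  simp only [mem_preimage, mem_voidEvent, Config.shift, eq_empty_iff_forall_notMem, mem_inter_iff]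
  exact ⟨fun h x => by simpa using h (x - v), fun h x => by simpa using h (x + v)⟩

theorem measurable_shift (v : EuclideanSpace ℝ (Fin d)) : Measurable (Config.shift v) := by
  have h := measurable_generateFrom (f := Config.shift v) (s := voidEvents d) (by
    rintro _ ⟨B, hB, -, rfl⟩
    rw [preimage_shift_voidEvent]
    exact measurableSet_voidEvent (hB.preimage (measurable_id.sub_const v)))
  rwa [← generateFrom_voidEvents] at h

theorem field_shift (l : ℝ → ℝ≥0) (v : EuclideanSpace ℝ (Fin d)) (ξ : Config d)
    (y : EuclideanSpace ℝ (Fin d)) : field l (ξ.shift v) y = field l ξ (y + v) := by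
  let e : (ξ.shift v).points ≃ ξ.points := (Equiv.addRight v).subtypeEquiv fun _ => Iff.rfl
  refine Eq.trans (tsum_congr fun x => ?_) (e.tsum_eq _)
  change _ = attenuation l ‖((x : EuclideanSpace ℝ (Fin d)) + v) - (y + v)‖
  rw [add_sub_add_right_eq_sub]

theorem percolates_preimage_add_iff (v : EuclideanSpace ℝ (Fin d))
    (A : Set (EuclideanSpace ℝ (Fin d))) : Percolates ((· + v) ⁻¹' A) ↔ Percolates A := by
  have key : ∀ (w : EuclideanSpace ℝ (Fin d)) (D : Set (EuclideanSpace ℝ (Fin d))),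
      Percolates D → Percolates ((· - w) ⁻¹' D) := by
    rintro w D ⟨y, hy, hub⟩
    have h := (Homeomorph.addRight w).image_connectedComponentIn hy
    have himage : (Homeomorph.addRight w) '' D = (· - w) ⁻¹' D := by
      ext x; simp [sub_eq_add_neg]
    rw [himage] at h
    refine ⟨y + w, by simpa using hy, fun hb => hub ?_⟩
    have hb' := isBounded_preimage_sub hb (-w)
    refine hb'.subset fun x hx => ?_
    have : x + w ∈ connectedComponentIn ((· - w) ⁻¹' D) (y + w) :=
      h.subset (mem_image_of_mem _ hx)
    simpa using this
  constructor
  · intro h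
    simpa [preimage_preimage] using key v _ h
  · intro h
    simpa using key (-v) A h

theorem percolates_levelGE_shift_iff (l : ℝ → ℝ≥0) (v : EuclideanSpace ℝ (Fin d)) (ξ : Config d)
    (h : ℝ) : Percolates (levelGE l (ξ.shift v) h) ↔ Percolates (levelGE l ξ h) := by
  rw [← percolates_preimage_add_iff v (levelGE l ξ h)]
  simp only [levelGE, field_shift, preimage_ofPred_eq]

theorem percolates_levelGT_shift_iff (l : ℝ → ℝ≥0) (v : EuclideanSpace ℝ (Fin d)) (ξ : Config d)
    (h : ℝ) : Percolates (levelGT l (ξ.shift v) h) ↔ Percolates (levelGT l ξ h) := by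
  rw [← percolates_preimage_add_iff v (levelGT l ξ h)]
  simp only [levelGT, field_shift, preimage_ofPred_eq]

end Shift

/-! ### Ergodicity of the Poisson process under translations -/

section Poisson

variable {Ω : Type*} [MeasurableSpace Ω] {P : Measure Ω} {d : ℕ} {lam : ℝ≥0} {η : Ω → Config d}

theorem volume_preimage_sub {B : Set (EuclideanSpace ℝ (Fin d))} (v : EuclideanSpace ℝ (Fin d)) :
    volume ((· - v) ⁻¹' B) = volume B := by
  simp only [sub_eq_add_neg, measure_preimage_add_right]

theorem IsPoissonProcess.map_voidEvent (hη : IsPoissonProcess lam η P)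
    {B : Set (EuclideanSpace ℝ (Fin d))} (hB : MeasurableSet B) (hBb : Bornology.IsBounded B) :
    P.map η (voidEvent B) = poissonMeasure (lam * (volume B).toNNReal) {0} := by
  rw [Measure.map_apply hη.measurable (measurableSet_voidEvent hB)]
  exact hη.count_law B hB hBb.measure_lt_top.ne 0

theorem IsPoissonProcess.map_real_voidEvent (hη : IsPoissonProcess lam η P)
    {B : Set (EuclideanSpace ℝ (Fin d))} (hB : MeasurableSet B) (hBb : Bornology.IsBounded B) :
    (P.map η).real (voidEvent B) = Real.exp (-(lam * volume.real B)) := by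
  rw [measureReal_def, hη.map_voidEvent hB hBb, ← measureReal_def, poissonMeasure_real_singleton]
  simp only [pow_zero, Nat.factorial_zero, Nat.cast_one, div_one, mul_one, NNReal.coe_mul,
    measureReal_def, ENNReal.coe_toNNReal_eq_toReal]

/-- The law of a Poisson process is translation invariant, because it is determined by the
probabilities of the void events, which depend on volumes only. -/
theorem IsPoissonProcess.measurePreserving_shift [IsProbabilityMeasure P]
    (hη : IsPoissonProcess lam η P) (v : EuclideanSpace ℝ (Fin d)) :
    MeasurePreserving (Config.shift v) (P.map η) (P.map η) := by
  have := Measure.isProbabilityMeasure_map (μ := P) hη.measurable.aemeasurable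
  have := Measure.isProbabilityMeasure_map (μ := P.map η) (measurable_shift v).aemeasurable
  refine ⟨measurable_shift v, ext_of_generate_finite (voidEvents d) generateFrom_voidEvents
    isPiSystem_voidEvents ?_ (by simp only [measure_univ])⟩
  rintro _ ⟨B, hB, hBb, rfl⟩
  have hBm : MeasurableSet ((· - v) ⁻¹' B) := hB.preimage (measurable_id.sub_const v)
  rw [Measure.map_apply (measurable_shift v) (measurableSet_voidEvent hB),
    preimage_shift_voidEvent, hη.map_voidEvent hB hBb,
    hη.map_voidEvent hBm (isBounded_preimage_sub hBb v),
    volume_preimage_sub]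

theorem eventually_disjoint_preimage_sub_nsmul {A B : Set (EuclideanSpace ℝ (Fin d))}
    (hA : Bornology.IsBounded A) (hB : Bornology.IsBounded B) {v : EuclideanSpace ℝ (Fin d)}
    (hv : v ≠ 0) : ∀ᶠ n : ℕ in atTop, Disjoint A ((· - n • v) ⁻¹' B) := by
  obtain ⟨a, ha⟩ := hA.exists_norm_le
  obtain ⟨b, hb⟩ := hB.exists_norm_le
  have hlim : Tendsto (fun n : ℕ => (n : ℝ) * ‖v‖) atTop atTop :=
    tendsto_natCast_atTop_atTop.atTop_mul_const (norm_pos_iff.2 hv)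
  filter_upwards [hlim.eventually_gt_atTop (a + b)] with n hn
  refine disjoint_left.2 fun x hxA hxB => hn.not_ge ?_
  calc (n : ℝ) * ‖v‖ = ‖x - (x - n • v)‖ := by
        rw [sub_sub_cancel, ← Nat.cast_smul_eq_nsmul ℝ, norm_smul, Real.norm_natCast]
    _ ≤ a + b := (norm_sub_le _ _).trans (add_le_add (ha x hxA) (hb _ hxB))

/-- Void events of bounded sets become exactly independent once one set is translated far away. -/
theorem IsPoissonProcess.tendsto_inter_shift (hη : IsPoissonProcess lam η P)
    {v : EuclideanSpace ℝ (Fin d)} (hv : v ≠ 0) {E F : Set (Config d)} (hE : E ∈ voidEvents d)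
    (hF : F ∈ voidEvents d) :
    Tendsto (fun n : ℕ => (P.map η).real (E ∩ Config.shift (n • v) ⁻¹' F)) atTop
      (𝓝 ((P.map η).real E * (P.map η).real F)) := by
  obtain ⟨A, hA, hAb, rfl⟩ := hE
  obtain ⟨B, hB, hBb, rfl⟩ := hF
  refine tendsto_const_nhds.congr' ?_
  filter_upwards [eventually_disjoint_preimage_sub_nsmul hAb hBb hv] with n hn
  have hBm : MeasurableSet ((· - n • v) ⁻¹' B) := hB.preimage (measurable_id.sub_const _)
  have hBb' := isBounded_preimage_sub hBb (n • v)
  rw [preimage_shift_voidEvent, voidEvent_inter_voidEvent, hη.map_real_voidEvent hA hAb,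
    hη.map_real_voidEvent hB hBb, hη.map_real_voidEvent (hA.union hBm) (hAb.union hBb'),
    measureReal_union hn hBm hAb.measure_lt_top.ne hBb'.measure_lt_top.ne,
    measureReal_def volume ((· - n • v) ⁻¹' B), volume_preimage_sub, ← measureReal_def,
    ← Real.exp_add]
  ring_nf

/-- Every translation-invariant set of configurations, measurable or not, has outer measure `0` or
`1` under the law of a Poisson process. -/
theorem IsPoissonProcess.map_eq_zero_or_one [IsProbabilityMeasure P]
    (hη : IsPoissonProcess lam η P) (hd : 1 ≤ d) {S : Set (Config d)}
    (hS : ∀ v, Config.shift v ⁻¹' S = S) : P.map η S = 0 ∨ P.map η S = 1 := by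
  have := Measure.isProbabilityMeasure_map (μ := P) hη.measurable.aemeasurable
  have : Nonempty (Fin d) := ⟨⟨0, hd⟩⟩
  obtain ⟨v, hv⟩ := exists_ne (0 : EuclideanSpace ℝ (Fin d))
  exact measure_eq_zero_or_one_of_mixing (T := fun n : ℕ => Config.shift (n • v))
    generateFrom_voidEvents isPiSystem_voidEvents (fun n => hη.measurePreserving_shift _)
    (fun E hE F hF => hη.tendsto_inter_shift hv hE hF) fun n => hS _

end Poisson

end LevelsetPercolation

/-- `P.map η` is the law of the Poisson process `η`. For a set `S` of configurations that is
measurable up to a null set of this law, `P.map η S` is the probability that `η` lies in `S`.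
No measurability is assumed: in general `P.map η S` is the outer measure of `S` and
`1 - P.map η Sᶜ` is its inner measure, and both are shown to be `0` or `1`. -/
theorem proposition1p1 {Ω : Type*} [MeasurableSpace Ω] (P : Measure Ω) [IsProbabilityMeasure P]
    (d : ℕ) (hd : 1 ≤ d) (lam : ℝ≥0) (hlam : 0 < lam)
    (η : Ω → LevelsetPercolation.Config d) (hη : LevelsetPercolation.IsPoissonProcess lam η P)
    (l : ℝ → ℝ≥0) (hl : AntitoneOn l (Ioi 0)) (h : ℝ) (hh : 0 < h) :
    ((P.map η {ξ | LevelsetPercolation.Percolates (LevelsetPercolation.levelGE l ξ h)} = 0 ∨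
        P.map η {ξ | LevelsetPercolation.Percolates (LevelsetPercolation.levelGE l ξ h)} = 1) ∧
      (P.map η {ξ | ¬ LevelsetPercolation.Percolates (LevelsetPercolation.levelGE l ξ h)} = 0 ∨
        P.map η {ξ | ¬ LevelsetPercolation.Percolates (LevelsetPercolation.levelGE l ξ h)} = 1)) ∧
    ((P.map η {ξ | LevelsetPercolation.Percolates (LevelsetPercolation.levelGT l ξ h)} = 0 ∨
        P.map η {ξ | LevelsetPercolation.Percolates (LevelsetPercolation.levelGT l ξ h)} = 1) ∧
      (P.map η {ξ | ¬ LevelsetPercolation.Percolates (LevelsetPercolation.levelGT l ξ h)} = 0 ∨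
        P.map η {ξ | ¬ LevelsetPercolation.Percolates (LevelsetPercolation.levelGT l ξ h)} = 1)) := by
  refine ⟨⟨hη.map_eq_zero_or_one hd fun v => ?_, hη.map_eq_zero_or_one hd fun v => ?_⟩,
    ⟨hη.map_eq_zero_or_one hd fun v => ?_, hη.map_eq_zero_or_one hd fun v => ?_⟩⟩
  · exact ext fun ξ => LevelsetPercolation.percolates_levelGE_shift_iff l v ξ h
  · exact ext fun ξ => (LevelsetPercolation.percolates_levelGE_shift_iff l v ξ h).not
  · exact ext fun ξ => LevelsetPercolation.percolates_levelGT_shift_iff l v ξ h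
  · exact ext fun ξ => (LevelsetPercolation.percolates_levelGT_shift_iff l v ξ h).not
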